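/- Let $\mu$ denote the Möbius function. For real $x$ put $M(x)=\sum_{1\le n\le x}\mu(n)$, the sum being over positive integers $n$, and for real $x\ge 0$ put $H(x)=e^{-\sqrt{x}}\,M\!\left(e^{\sqrt{x}}\right)$. Then $$\lim_{x\to+\infty}H(x)=0,$$ and equivalently $$\lim_{x\to+\infty}\frac{M(x)}{x}=0,$$ where in both limits $x$ tends to $+\infty$ through the real numbers. -/

import Mathlib

/-- The summatory function of the Möbius function, `M(x) = ∑_{1 ≤ n ≤ x} μ(n)`, for real `x`. -/
noncomputable def mertensM (x : ℝ) : ℝ :=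
  ∑ n ∈ Finset.Icc 1 ⌊x⌋₊, (ArithmeticFunction.moebius n : ℝ)

/-- `H(x) = e^{-√x} M(e^{√x})`, of interest for real `x ≥ 0`. -/
noncomputable def mertensH (x : ℝ) : ℝ :=
  Real.exp (-Real.sqrt x) * mertensM (Real.exp (Real.sqrt x))

/-! ### A Fourier-analytic Tauberian theorem. -/

section FourierTauberian

open MeasureTheory Filter Topology Real
open scoped FourierTransform ContDiff

/-! Put `g(t) = e^{-t} M(e^t)`. It is bounded, oscillates slowly, and has Laplace transform
`1/((1+s) ζ(1+s))`, continuous on `Re s ≥ 0` because `ζ` has no zeros on `Re = 1` and its pole only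
makes the reciprocal vanish. Averages of `g` around `u` against a kernel `𝓕 φ`, `φ` compactly
supported, are Fourier transforms at `-u` (`integral_mul_fourier_sub_eq`), so they vanish as `u → ∞`
by Riemann–Lebesgue. Slow oscillation keeps `g(u)` near its average when the kernel is concentrated,
hence `g → 0`. Both limits follow with `t = √x` and `t = log x`. -/

/-- Modulating a function translates its Fourier transform. -/
theorem fourier_modulate (φ : ℝ → ℂ) (u t : ℝ) :
    𝓕 (fun y : ℝ => 𝐞 (y * u) • φ y) t = 𝓕 φ (t - u) := by
  rw [Real.fourier_eq, Real.fourier_eq]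
  refine integral_congr_ae (.of_forall fun y => ?_)
  simp only [smul_smul, ← AddChar.map_add_eq_mul]
  congr 2
  simp [inner]
  ring

/-- The Fourier transform on the real line is self-adjoint. -/
theorem integral_fourier_mul_eq_integral_mul_fourier {f φ : ℝ → ℂ} (hf : Integrable f)
    (hφ : Integrable φ) : ∫ y, 𝓕 f y * φ y = ∫ t, f t * 𝓕 φ t := by
  simpa using! VectorFourier.integral_fourierIntegral_smul_eq_flip (L := innerₗ ℝ)
    continuous_fourierChar continuous_inner hf hφ

/-- Dilating a function contracts its Fourier transform. -/
theorem fourier_comp_div (f : ℝ → ℂ) {c : ℝ} (hc : 0 < c) (v : ℝ) :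
    𝓕 (fun y => f (y / c)) v = c * 𝓕 f (c * v) := by
  rw [Real.fourier_eq, Real.fourier_eq]
  have h := Measure.integral_comp_div (fun y : ℝ => 𝐞 (-(inner ℝ y (c * v))) • f y) c
  rw [abs_of_pos hc, Complex.real_smul] at h
  rw [← h]
  refine integral_congr_ae (.of_forall fun y => ?_)
  simp only
  congr 3
  simp [inner]
  field_simp

/-- There are compactly supported continuous functions whose Fourier transforms have mass one and
arbitrarily small first absolute moment. -/
theorem exists_hasCompactSupport_fourier_moment_le {ε : ℝ} (hε : 0 < ε) :
    ∃ φ : ℝ → ℂ, Continuous φ ∧ HasCompactSupport φ ∧ Integrable (𝓕 φ) ∧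
      Integrable (fun v => |v| * ‖𝓕 φ v‖) ∧ ∫ v, 𝓕 φ v = 1 ∧ ∫ v, |v| * ‖𝓕 φ v‖ ≤ ε := by
  let b : ContDiffBump (0 : ℝ) := ⟨1, 2, one_pos, one_lt_two⟩
  have hbs : HasCompactSupport (fun y => (b y : ℂ)) :=
    b.hasCompactSupport.comp_left Complex.ofReal_zero
  let f : SchwartzMap ℝ ℂ := hbs.toSchwartzMap (Complex.ofRealCLM.contDiff.comp b.contDiff)
  have hf0 : f 0 = 1 := by
    have : b 0 = 1 := b.one_of_mem_closedBall (by simp [b])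
    change ((b 0 : ℝ) : ℂ) = 1
    rw [this, Complex.ofReal_one]
  have hK : Integrable (𝓕 (f : ℝ → ℂ)) := by
    rw [← SchwartzMap.fourier_coe]; exact (𝓕 f).integrable
  have hK1 : Integrable (fun v => |v| * ‖𝓕 (f : ℝ → ℂ) v‖) := by
    rw [← SchwartzMap.fourier_coe]
    exact ((𝓕 f).integrable_pow_mul volume 1).congr (.of_forall fun v => by simp)
  have hmass : ∫ v, 𝓕 (f : ℝ → ℂ) v = 1 := by
    have := congrFun (f.continuous.fourierInv_fourier_eq f.integrable hK) 0
    rw [hf0, Real.fourierInv_eq] at this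
    simpa using this
  set C := ∫ v, |v| * ‖𝓕 (f : ℝ → ℂ) v‖ with hC
  have hC0 : 0 ≤ C := integral_nonneg fun v => by positivity
  -- Dilation by `c` divides the first moment by `c` and keeps the mass; the `+ 1` makes `c`
  -- positive even if `C = 0`.
  set c := C / ε + 1
  have hc : 0 < c := by positivity
  have hF : 𝓕 (fun y => f (y / c)) = fun v => (c : ℂ) * 𝓕 (f : ℝ → ℂ) (c * v) :=
    funext fun v => fourier_comp_div f hc v
  have hmom : (fun v => |v| * ‖𝓕 (fun y => f (y / c)) v‖) =
      fun v => (fun w => |w| * ‖𝓕 (f : ℝ → ℂ) w‖) (c * v) := by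
    ext v
    simp only [hF, norm_mul, Complex.norm_real, norm_eq_abs, abs_mul]
    ring
  refine ⟨fun y => f (y / c), by fun_prop, ?_, ?_, ?_, ?_, ?_⟩
  · have : HasCompactSupport (f : ℝ → ℂ) := hbs
    simpa [div_eq_mul_inv, mul_comm] using this.comp_smul (inv_ne_zero hc.ne')
  · rw [hF]
    exact (hK.comp_mul_left' hc.ne').const_mul _
  · rw [hmom]
    exact hK1.comp_mul_left' hc.ne'
  · rw [hF, integral_const_mul, Measure.integral_comp_mul_left, hmass, abs_of_pos (inv_pos.2 hc)]
    simp [hc.ne']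
  · rw [hmom, Measure.integral_comp_mul_left (fun w => |w| * ‖𝓕 (f : ℝ → ℂ) w‖), abs_of_pos (inv_pos.2 hc), ← hC, smul_eq_mul,
      inv_mul_le_iff₀ hc]
    have : C = C / ε * ε := by field_simp
    nlinarith

/-- If the Laplace transform of a bounded function extends continuously to the closed half-plane,
then its convolutions with Fourier transforms of test functions are Fourier transforms. -/
theorem integral_mul_fourier_sub_eq {g : ℝ → ℂ} {C : ℝ} (hgm : AEStronglyMeasurable g)
    (hb : ∀ t, ‖g t‖ ≤ C) (h0 : ∀ t < 0, g t = 0) {L : ℂ → ℂ}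
    (hL : ContinuousOn L {s | 0 ≤ s.re})
    (hgL : ∀ σ : ℝ, 0 < σ → ∀ y : ℝ,
      𝓕 (fun t : ℝ => rexp (-σ * t) • g t) y = L (σ + 2 * π * y * Complex.I))
    {φ : ℝ → ℂ} (hφ : Continuous φ) (hφs : HasCompactSupport φ) (hφF : Integrable (𝓕 φ)) (u : ℝ) :
    ∫ t, g t * 𝓕 φ (t - u) = 𝓕 (fun y : ℝ => L (2 * π * y * Complex.I) * φ y) (-u) := by
  have hC : 0 ≤ C := (norm_nonneg _).trans (hb 0)
  have hφi : Integrable φ := hφ.integrable_of_hasCompactSupport hφs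
  have hexp : ∀ σ : ℝ, 0 < σ → ∀ t, ‖rexp (-σ * t) • g t‖ ≤ ‖g t‖ := by
    intro σ hσ t
    rcases lt_or_ge t 0 with ht | ht
    · simp [h0 t ht]
    · rw [norm_smul, norm_eq_abs, abs_exp]
      refine mul_le_of_le_one_left (norm_nonneg _) (exp_le_one_iff.2 ?_)
      nlinarith
  have hgσ : ∀ σ : ℝ, 0 < σ → Integrable (fun t : ℝ => rexp (-σ * t) • g t) := by
    intro σ hσ
    -- The endpoint is `-1`, not `0`, since `g 0` need not vanish.
    have h1 : IntegrableOn (fun t : ℝ => C * rexp (-σ * t)) (Set.Ioi (-1)) :=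
      (integrableOn_exp_mul_Ioi (neg_lt_zero.2 hσ) _).const_mul _
    rw [← integrable_indicator_iff measurableSet_Ioi] at h1
    refine h1.mono' ((by fun_prop : Continuous fun t : ℝ => rexp (-σ * t)).aestronglyMeasurable.smul
      hgm) (.of_forall fun t => ?_)
    by_cases ht : t ∈ Set.Ioi (-1 : ℝ)
    · rw [Set.indicator_of_mem ht, norm_smul, norm_eq_abs, abs_exp, mul_comm]
      gcongr
      exact hb t
    · rw [Set.indicator_of_notMem ht, h0 t (by simp at ht; linarith)]
      simp
  have hKu : Integrable (fun t => 𝓕 φ (t - u)) := hφF.comp_sub_right u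
  -- The same integrals are computed as `σ ↓ 0` on both sides of the Fourier duality: `lim1` on the
  -- `t` side, `lim2` on the `y` side.
  have lim1 : Tendsto (fun σ : ℝ => ∫ t, (rexp (-σ * t) • g t) * 𝓕 φ (t - u)) (𝓝[>] 0)
      (𝓝 (∫ t, g t * 𝓕 φ (t - u))) := by
    refine tendsto_integral_filter_of_dominated_convergence (fun t => C * ‖𝓕 φ (t - u)‖)
      ?_ ?_ (hKu.norm.const_mul C) (.of_forall fun t => ?_)
    · filter_upwards [self_mem_nhdsWithin] with σ hσ
      exact (hgσ σ hσ).aestronglyMeasurable.mul hKu.aestronglyMeasurable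
    · filter_upwards [self_mem_nhdsWithin] with σ hσ
      refine .of_forall fun t => ?_
      rw [norm_mul]
      gcongr
      exact (hexp σ hσ t).trans (hb t)
    · have : Continuous fun σ : ℝ => (rexp (-σ * t) • g t) * 𝓕 φ (t - u) := by fun_prop
      simpa using (this.tendsto 0).mono_left nhdsWithin_le_nhds
  have hmφ : Continuous fun y : ℝ => 𝐞 (y * u) • φ y := by fun_prop
  have hmφi : Integrable fun y : ℝ => 𝐞 (y * u) • φ y := by
    refine hφi.mono hmφ.aestronglyMeasurable (.of_forall fun y => ?_)
    simp
  obtain ⟨B, hB⟩ : ∃ B, ∀ p ∈ Set.Icc (0 : ℝ) 1 ×ˢ tsupport φ,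
      ‖L (p.1 + 2 * π * p.2 * Complex.I)‖ ≤ B := by
    refine (isCompact_Icc.prod hφs).exists_bound_of_continuousOn ?_
    refine hL.comp (by fun_prop) fun p hp => ?_
    simpa using hp.1.1
  have lim2 : Tendsto (fun σ : ℝ => ∫ t, (rexp (-σ * t) • g t) * 𝓕 φ (t - u)) (𝓝[>] 0)
      (𝓝 (∫ y : ℝ, L (2 * π * y * Complex.I) * (𝐞 (y * u) • φ y))) := by
    have heq : ∀ᶠ σ : ℝ in 𝓝[>] 0,
        ∫ y : ℝ, L (σ + 2 * π * y * Complex.I) * (𝐞 (y * u) • φ y) =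
          ∫ t, (rexp (-σ * t) • g t) * 𝓕 φ (t - u) := by
      filter_upwards [self_mem_nhdsWithin] with σ hσ
      simp_rw [← fourier_modulate, ← hgL σ hσ]
      exact integral_fourier_mul_eq_integral_mul_fourier (hgσ σ hσ) hmφi
    refine Tendsto.congr' heq ?_
    have hLσ : ∀ σ : ℝ, 0 ≤ σ → Continuous fun y : ℝ => L (σ + 2 * π * y * Complex.I) := by
      intro σ hσ
      exact hL.comp_continuous (by fun_prop) fun y => by simpa using hσ
    refine tendsto_integral_filter_of_dominated_convergence (fun y => B * ‖φ y‖)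
      ?_ ?_ (hφi.norm.const_mul B) (.of_forall fun y => ?_)
    · filter_upwards [self_mem_nhdsWithin] with σ hσ
      exact ((hLσ σ (le_of_lt hσ)).mul hmφ).aestronglyMeasurable
    · filter_upwards [Ioc_mem_nhdsGT one_pos] with σ hσ
      refine .of_forall fun y => ?_
      rw [norm_mul, Circle.norm_smul]
      by_cases hy : y ∈ tsupport φ
      · gcongr
        exact hB (σ, y) ⟨⟨hσ.1.le, hσ.2⟩, hy⟩
      · simp [image_eq_zero_of_notMem_tsupport hy]
    · refine Tendsto.mul_const _ ?_
      have hc : ContinuousOn (fun σ : ℝ => L (σ + 2 * π * y * Complex.I)) (Set.Ici 0) :=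
        hL.comp (by fun_prop) fun σ hσ => by simpa using hσ
      have := (hc 0 Set.self_mem_Ici).mono Set.Ioi_subset_Ici_self
      simpa [ContinuousWithinAt] using this
  rw [tendsto_nhds_unique lim1 lim2, Real.fourier_eq]
  refine integral_congr_ae (.of_forall fun y => ?_)
  simp only [inner, Circle.smul_def, smul_eq_mul]
  simp
  ring_nf

/-- **Tauberian theorem.** A bounded slowly oscillating function whose Laplace transform extends
continuously to the closed half-plane tends to zero. -/
theorem tendsto_zero_of_laplace_continuousOn {g : ℝ → ℂ} {C A : ℝ} {δ : ℝ → ℝ}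
    (hgm : AEStronglyMeasurable g)
    (hb : ∀ t, ‖g t‖ ≤ C) (h0 : ∀ t < 0, g t = 0) {L : ℂ → ℂ}
    (hL : ContinuousOn L {s | 0 ≤ s.re})
    (hgL : ∀ σ : ℝ, 0 < σ → ∀ y : ℝ,
      𝓕 (fun t : ℝ => rexp (-σ * t) • g t) y = L (σ + 2 * π * y * Complex.I))
    (hA : 0 < A) (hδ : Tendsto δ atTop (𝓝 0)) (hosc : ∀ u v, ‖g (u + v) - g u‖ ≤ A * |v| + δ u) :
    Tendsto g atTop (𝓝 0) := by
  rw [Metric.tendsto_nhds]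
  intro ε hε
  obtain ⟨φ, hφ, hφs, hφF, hφF1, hmass, hmom⟩ :=
    -- With this moment the term `A * |v|` contributes at most `ε / 2`.
    exists_hasCompactSupport_fourier_moment_le (ε := ε / (2 * A)) (by positivity)
  set N := ∫ v, ‖𝓕 φ v‖
  have hconv : Tendsto (fun u => ∫ t, g t * 𝓕 φ (t - u)) atTop (𝓝 0) := by
    simp_rw [integral_mul_fourier_sub_eq hgm hb h0 hL hgL hφ hφs hφF]
    exact ((Real.zero_at_infty_fourier _).mono_left atBot_le_cocompact).comp tendsto_neg_atTop_atBot
  have hlim : Tendsto (fun u => ε / 2 + δ u * N + ‖∫ t, g t * 𝓕 φ (t - u)‖) atTop (𝓝 (ε / 2)) := by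
    simpa using (tendsto_const_nhds.add (hδ.mul_const N)).add hconv.norm
  filter_upwards [hlim.eventually_lt_const (half_lt_self hε)] with u hu
  rw [dist_zero_right]
  refine lt_of_le_of_lt ?_ hu
  have hshift : ∫ t, g t * 𝓕 φ (t - u) = ∫ v, g (u + v) * 𝓕 φ v := by
    rw [← integral_add_left_eq_self _ u]
    simp
  have hgi : Integrable fun v => g (u + v) * 𝓕 φ v :=
    hφF.bdd_mul (hgm.comp_measurePreserving (measurePreserving_add_left volume u))
      (.of_forall fun v => hb (u + v))
  have hdiff : ‖(∫ v, g (u + v) * 𝓕 φ v) - g u‖ ≤ ε / 2 + δ u * N := by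
    have h1 : (∫ v, g (u + v) * 𝓕 φ v) - g u = ∫ v, (g (u + v) - g u) * 𝓕 φ v := by
      simp_rw [sub_mul]
      rw [integral_sub hgi (hφF.const_mul _), integral_const_mul, hmass, mul_one]
    rw [h1]
    have hint : Integrable fun v => A * (|v| * ‖𝓕 φ v‖) + δ u * ‖𝓕 φ v‖ :=
      (hφF1.const_mul A).add (hφF.norm.const_mul _)
    refine (norm_integral_le_of_norm_le hint (.of_forall fun v => ?_)).trans ?_
    · rw [norm_mul, ← mul_assoc, ← add_mul]
      gcongr
      exact hosc u v
    · rw [integral_add (hφF1.const_mul A) (hφF.norm.const_mul _), integral_const_mul,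
        integral_const_mul]
      gcongr
      calc A * ∫ v, |v| * ‖𝓕 φ v‖ ≤ A * (ε / (2 * A)) := by gcongr
        _ = ε / 2 := by field_simp
  rw [hshift]
  have := norm_sub_le (∫ v, g (u + v) * 𝓕 φ v) ((∫ v, g (u + v) * 𝓕 φ v) - g u)
  rw [sub_sub_cancel] at this
  linarith

end FourierTauberian

/-! ### The Mertens function and its Laplace transform. -/

section Mertens

open MeasureTheory Filter Topology Real
open scoped FourierTransform

theorem abs_mertensM_sub_le {x y : ℝ} (hx : 0 ≤ x) (hxy : x ≤ y) :
    |mertensM y - mertensM x| ≤ y - x + 1 := by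
  have hfl : ⌊x⌋₊ ≤ ⌊y⌋₊ := Nat.floor_mono hxy
  have hunion : Finset.Icc 1 ⌊y⌋₊ = Finset.Icc 1 ⌊x⌋₊ ∪ Finset.Ioc ⌊x⌋₊ ⌊y⌋₊ := by
    ext n; simp; omega
  have hdisj : Disjoint (Finset.Icc 1 ⌊x⌋₊) (Finset.Ioc ⌊x⌋₊ ⌊y⌋₊) := by
    rw [Finset.disjoint_left]; intro n; simp; omega
  have h1 : mertensM y - mertensM x =
      ∑ n ∈ Finset.Ioc ⌊x⌋₊ ⌊y⌋₊, (ArithmeticFunction.moebius n : ℝ) := by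
    rw [mertensM, mertensM, hunion, Finset.sum_union hdisj, add_sub_cancel_left]
  have hcard : ((Finset.Ioc ⌊x⌋₊ ⌊y⌋₊).card : ℝ) = (⌊y⌋₊ : ℝ) - ⌊x⌋₊ := by
    rw [Nat.card_Ioc, Nat.cast_sub hfl]
  rw [h1]
  calc _ ≤ ∑ n ∈ Finset.Ioc ⌊x⌋₊ ⌊y⌋₊, |(ArithmeticFunction.moebius n : ℝ)| :=
        Finset.abs_sum_le_sum_abs _ _
    _ ≤ ∑ n ∈ Finset.Ioc ⌊x⌋₊ ⌊y⌋₊, (1 : ℝ) :=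
        Finset.sum_le_sum fun n _ => mod_cast ArithmeticFunction.abs_moebius_le_one
    _ = (⌊y⌋₊ : ℝ) - ⌊x⌋₊ := by rw [Finset.sum_const, nsmul_one, hcard]
    _ ≤ _ := by
      have := Nat.floor_le (hx.trans hxy)
      have := Nat.lt_floor_add_one x
      linarith

theorem mertensM_of_lt_one {x : ℝ} (hx : x < 1) : mertensM x = 0 := by
  simp [mertensM, Nat.floor_eq_zero.2 hx]

theorem abs_mertensM_le {x : ℝ} (hx : 0 ≤ x) : |mertensM x| ≤ x := by
  calc |mertensM x| ≤ ∑ n ∈ Finset.Icc 1 ⌊x⌋₊, |(ArithmeticFunction.moebius n : ℝ)| :=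
        Finset.abs_sum_le_sum_abs _ _
    _ ≤ ∑ n ∈ Finset.Icc 1 ⌊x⌋₊, (1 : ℝ) :=
        Finset.sum_le_sum fun n _ => mod_cast ArithmeticFunction.abs_moebius_le_one
    _ = ⌊x⌋₊ := by simp
    _ ≤ x := Nat.floor_le hx

theorem measurable_mertensM : Measurable mertensM :=
  (measurable_from_nat (f := fun n => ∑ k ∈ Finset.Icc 1 n,
    (ArithmeticFunction.moebius k : ℝ))).comp Nat.measurable_floor

/-- The function `t ↦ M(e^t) / e^t` oscillates slowly. -/
theorem abs_exp_neg_mul_mertensM_exp_sub_le (u v : ℝ) :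
    |rexp (-(u + v)) * mertensM (rexp (u + v)) - rexp (-u) * mertensM (rexp u)| ≤
      2 * |v| + rexp (-u) := by
  -- The error sits at the larger endpoint, so it is at most `e^{-u}` for either sign of `v`.
  have key : ∀ a b : ℝ, a ≤ b →
      |rexp (-b) * mertensM (rexp b) - rexp (-a) * mertensM (rexp a)| ≤
        2 * (b - a) + rexp (-b) := by
    intro a b hab
    have h1 := abs_mertensM_sub_le (exp_pos a).le (exp_le_exp.2 hab)
    have h2 := abs_mertensM_le (exp_pos a).le
    have h3 : rexp (-b) ≤ rexp (-a) := exp_le_exp.2 (by linarith)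
    have ha : rexp (-a) * rexp a = 1 := by rw [← exp_add]; simp
    have hb : rexp (-b) * rexp b = 1 := by rw [← exp_add]; simp
    have hab' : 1 - rexp (-b) * rexp a ≤ b - a := by
      rw [← exp_add]
      linarith [add_one_le_exp (-b + a)]
    have heq : rexp (-b) * mertensM (rexp b) - rexp (-a) * mertensM (rexp a) =
        rexp (-b) * (mertensM (rexp b) - mertensM (rexp a)) -
          (rexp (-a) - rexp (-b)) * mertensM (rexp a) := by ring
    rw [heq]
    refine (abs_sub _ _).trans ?_
    rw [abs_mul, abs_mul, abs_of_pos (exp_pos _), abs_of_nonneg (sub_nonneg.2 h3)]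
    have h4 := mul_le_mul_of_nonneg_left h1 (exp_pos (-b)).le
    have h5 := mul_le_mul_of_nonneg_left h2 (sub_nonneg.2 h3)
    -- `h4` and `h5` add up to `2 (1 - e^{a-b}) + e^{-b}`.
    nlinarith
  rcases le_total 0 v with hv | hv
  · refine (key u (u + v) (by linarith)).trans ?_
    have : rexp (-(u + v)) ≤ rexp (-u) := exp_le_exp.2 (by linarith)
    rw [abs_of_nonneg hv]
    linarith
  · rw [abs_sub_comm]
    refine (key (u + v) u (by linarith)).trans ?_
    rw [abs_of_nonpos hv]
    linarith

/-- The function `1 / (s ζ(s))`, with its removable singularity at `s = 1` filled in. -/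
noncomputable def invMulZeta : ℂ → ℂ :=
  Function.update (fun s => (s * riemannZeta s)⁻¹) 1 0

theorem continuousOn_invMulZeta : ContinuousOn invMulZeta {s | 1 ≤ s.re} := by
  intro s hs
  refine ContinuousAt.continuousWithinAt ?_
  have hs0 : s ≠ 0 := by rintro rfl; norm_num at hs
  by_cases h : s = 1
  · subst h
    rw [invMulZeta, continuousAt_update_same]
    -- Factoring out `s - 1` leaves a finite limit, by the residue of `ζ`.
    have h1 : Tendsto (fun s : ℂ => (s - 1) * (s * ((s - 1) * riemannZeta s))⁻¹) (𝓝[≠] 1)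
        (𝓝 ((1 - 1) * (1 * 1)⁻¹)) := by
      have hid : Tendsto (fun s : ℂ => s) (𝓝[≠] 1) (𝓝 1) := tendsto_id.mono_left nhdsWithin_le_nhds
      exact (hid.sub_const 1).mul ((hid.mul riemannZeta_residue_one).inv₀ (by norm_num))
    rw [sub_self, zero_mul] at h1
    refine h1.congr' ?_
    filter_upwards [self_mem_nhdsWithin] with z hz
    have : z - 1 ≠ 0 := sub_ne_zero.2 hz
    rw [mul_left_comm, mul_inv (z - 1), mul_inv_cancel_left₀ this]
  · rw [invMulZeta, continuousAt_update_of_ne h]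
    exact (continuousAt_id.mul (differentiableAt_riemannZeta h).continuousAt).inv₀
      (mul_ne_zero hs0 (riemannZeta_ne_zero_of_one_le_re hs))

/-- The Mellin representation of `1 / (s ζ(s))` by the Mertens function. -/
theorem invMulZeta_eq_integral {s : ℂ} (hs : 1 < s.re) :
    invMulZeta s = ∫ t in Set.Ioi (0 : ℝ), (mertensM t : ℂ) * (t : ℂ) ^ (-(s + 1)) := by
  have hs1 : s ≠ 1 := by rintro rfl; norm_num at hs
  have hO : (fun n : ℕ => ∑ k ∈ Finset.Icc 1 n, ‖((ArithmeticFunction.moebius k : ℤ) : ℂ)‖)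
      =O[atTop] fun n => (n : ℝ) ^ (1 : ℝ) := by
    refine Asymptotics.IsBigO.of_bound 1 (.of_forall fun n => ?_)
    rw [one_mul, Real.rpow_one, norm_of_nonneg (by positivity), norm_of_nonneg (by positivity)]
    calc _ ≤ ∑ k ∈ Finset.Icc 1 n, (1 : ℝ) := Finset.sum_le_sum fun k _ => by
          rw [Complex.norm_intCast]
          exact mod_cast ArithmeticFunction.abs_moebius_le_one
      _ = n := by simp
  have h1 := LSeries_eq_mul_integral' _ zero_le_one hs hO
  have h2 := ArithmeticFunction.LSeries_zeta_mul_Lseries_moebius hs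
  rw [ArithmeticFunction.LSeries_zeta_eq_riemannZeta hs, h1] at h2
  rw [invMulZeta, Function.update_of_ne hs1]
  have h3 : ∫ t in Set.Ioi (0 : ℝ), (mertensM t : ℂ) * (t : ℂ) ^ (-(s + 1)) =
      ∫ t in Set.Ioi (1 : ℝ), (mertensM t : ℂ) * (t : ℂ) ^ (-(s + 1)) := by
    rw [← integral_Ici_eq_integral_Ioi (x := (1 : ℝ))]
    refine setIntegral_eq_of_subset_of_forall_sdiff_eq_zero measurableSet_Ioi
      (fun t (ht : 1 ≤ t) => zero_lt_one.trans_le ht) fun t ht => ?_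
    rw [mertensM_of_lt_one (not_le.1 ht.2)]
    simp
  have h4 : ∀ t : ℝ, (mertensM t : ℂ) =
      ∑ k ∈ Finset.Icc 1 ⌊t⌋₊, ((ArithmeticFunction.moebius k : ℤ) : ℂ) := fun t => by
    simp [mertensM]
  rw [h3]
  simp_rw [h4]
  refine inv_eq_of_mul_eq_one_right ?_
  rwa [mul_comm s, mul_assoc]

/-- Substituting `x = e^{-t}` gives the Mellin transform of `x M(1/x)`; the factor `x` shifts `s` to
`s + 1`, and inverting `x` gives the integral for `invMulZeta`. -/
theorem fourier_exp_smul_mertensM (σ : ℝ) (hσ : 0 < σ) (y : ℝ) :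
    𝓕 (fun t : ℝ => rexp (-σ * t) • ((rexp (-t) * mertensM (rexp t) : ℝ) : ℂ)) y =
      invMulZeta (1 + (σ + 2 * π * y * Complex.I)) := by
  set s : ℂ := σ + 2 * π * y * Complex.I with hs
  have hre : s.re = σ := by simp [hs]
  have him : s.im / (2 * π) = y := by
    simp [hs]
  have h1 := mellin_eq_fourier (fun x : ℝ => ((x * mertensM x⁻¹ : ℝ) : ℂ)) (s := s)
  simp only [hre, him, ← Real.exp_neg, neg_neg] at h1
  rw [← h1, invMulZeta_eq_integral (by simp [hre, hσ])]
  have h2 : mellin (fun x : ℝ => ((x * mertensM x⁻¹ : ℝ) : ℂ)) s =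
      mellin (fun x : ℝ => (x : ℂ) ^ (1 : ℂ) • (fun x : ℝ => (mertensM x : ℂ)) x⁻¹) s := by
    simp
  rw [h2, mellin_cpow_smul, mellin_comp_inv (fun x : ℝ => (mertensM x : ℂ)), mellin]
  refine setIntegral_congr_fun measurableSet_Ioi fun t _ => ?_
  simp only [smul_eq_mul]
  rw [mul_comm]
  congr 2
  ring

theorem tendsto_exp_neg_mul_mertensM_exp :
    Tendsto (fun t => rexp (-t) * mertensM (rexp t)) atTop (𝓝 0) := by
  have h : Tendsto (fun t => ((rexp (-t) * mertensM (rexp t) : ℝ) : ℂ)) atTop (𝓝 0) := by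
    refine tendsto_zero_of_laplace_continuousOn (C := 1) (A := 2) (δ := fun u => rexp (-u))
      (L := fun s => invMulZeta (1 + s)) ?_ (fun t => ?_) (fun t ht => ?_) ?_
      fourier_exp_smul_mertensM two_pos tendsto_exp_neg_atTop_nhds_zero fun u v => ?_
    · refine (Complex.measurable_ofReal.comp ?_).aestronglyMeasurable
      exact (by fun_prop : Measurable fun t : ℝ => rexp (-t)).mul
        (measurable_mertensM.comp measurable_exp)
    · rw [Complex.norm_real, norm_mul, norm_eq_abs, norm_eq_abs, abs_exp]
      calc _ ≤ rexp (-t) * rexp t := by gcongr; exact abs_mertensM_le (exp_pos t).le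
        _ = 1 := by rw [← exp_add]; simp
    · simp [mertensM_of_lt_one (exp_lt_one_iff.2 ht)]
    · exact continuousOn_invMulZeta.comp (by fun_prop) fun s hs => by simpa using hs
    · rw [← Complex.ofReal_sub, Complex.norm_real]
      exact abs_exp_neg_mul_mertensM_exp_sub_le u v
  exact (Complex.continuous_re.tendsto 0).comp h

end Mertens

theorem corollary1 :
    Filter.Tendsto mertensH Filter.atTop (nhds 0) ∧
      Filter.Tendsto (fun x : ℝ => mertensM x / x) Filter.atTop (nhds 0) := by
  refine ⟨tendsto_exp_neg_mul_mertensM_exp.comp Real.tendsto_sqrt_atTop, ?_⟩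
  refine (tendsto_exp_neg_mul_mertensM_exp.comp Real.tendsto_log_atTop).congr' ?_
  filter_upwards [Filter.eventually_gt_atTop 0] with x hx
  simp only [Function.comp_apply, Real.exp_neg, Real.exp_log hx]
  rw [div_eq_inv_mul]
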